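/- Let $n\ge 1$, let $\gamma$ be the standard Gaussian measure on $\mathbb{R}^n$, and let $W_k(x)=x_1+\dots+x_k$ for $0\le k\le n$ (so $W_0=0$). Put $A_n=\bigcap_{k=0}^n\{W_k\le 0\}$. Then $$\gamma(A_n)=\binom{2n}{n}\frac1{4^n}.$$ For $u\in L^2(\gamma)$, the measure-derivative $D_\gamma u$ of $u$ (if it exists) is the $\mathbb{R}^n$-valued Borel measure of finite total variation such that $$\int g\,d\langle D_\gamma u,h\rangle=-\int u\,\big(\partial_h g-g\,\langle h,\cdot\rangle\big)\,d\gamma$$ for every $h\in\mathbb{R}^n$ and every smooth $g:\mathbb{R}^n\to\mathbb{R}$ that is bounded together with all its derivatives. Let $|D_\gamma u|$ denote its total variation measure. For $u=I_{\{W_n>0\}}$ the measure-derivative exists and is unique, the Gaussian perimeter $P_\gamma\{W_n>0\}=|D_\gamma I_{\{W_n>0\}}|(\mathbb{R}^n)$ is positive and finite, and $$\gamma(A_n\mid W_n=0):=\frac{|D_\gamma I_{\{W_n>0\}}|(A_n)}{P_\gamma\{W_n>0\}}=\frac1n .$$ -/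

import Mathlib

open MeasureTheory ProbabilityTheory
open scoped ENNReal

noncomputable section

namespace GaussianWalk

/-- The standard Gaussian measure `γ = γ_n` on `ℝⁿ`. -/
abbrev γ (n : ℕ) : Measure (EuclideanSpace ℝ (Fin n)) :=
  stdGaussian (EuclideanSpace ℝ (Fin n))

/-- The walk `W_k(x) = x_1 + ⋯ + x_k` (for `0 ≤ k ≤ n`), so that `W_0 = 0`. -/
def W (n k : ℕ) (x : EuclideanSpace ℝ (Fin n)) : ℝ :=
  ∑ i : Fin n with i.val < k, x i

/-- `A_n = ⋂_{k=0}^n {W_k ≤ 0}`. -/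
def A (n : ℕ) : Set (EuclideanSpace ℝ (Fin n)) :=
  {x | ∀ k ≤ n, W n k x ≤ 0}

/-- Test functions: smooth functions on `ℝⁿ` that are bounded together with all their
derivatives. -/
structure IsTestFunction {n : ℕ} (g : EuclideanSpace ℝ (Fin n) → ℝ) : Prop where
  contDiff : ContDiff ℝ (⊤ : ℕ∞) g
  bounded : ∀ k : ℕ, ∃ C : ℝ, ∀ x, ‖iteratedFDeriv ℝ k g x‖ ≤ C

/-- `∂*_h g = ∂_h g - g ⟨h, ·⟩`; the operator `-∂*_h` is the adjoint in `L²(γ)` of the directional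
derivative `∂_h`. -/
def adjDeriv {n : ℕ} (h : EuclideanSpace ℝ (Fin n)) (g : EuclideanSpace ℝ (Fin n) → ℝ)
    (x : EuclideanSpace ℝ (Fin n)) : ℝ :=
  fderiv ℝ g x h - g x * inner ℝ h x

/-- The signed measure `⟨D, h⟩` for an `ℝⁿ`-valued measure `D` and a vector `h`. -/
def component {n : ℕ} (D : VectorMeasure (EuclideanSpace ℝ (Fin n)) (EuclideanSpace ℝ (Fin n)))
    (h : EuclideanSpace ℝ (Fin n)) : SignedMeasure (EuclideanSpace ℝ (Fin n)) :=
  D.mapRange (innerSL ℝ h : EuclideanSpace ℝ (Fin n) →+ ℝ) (innerSL ℝ h).continuous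

/-- The `ℝⁿ`-valued measure `D` is the measure-derivative `D_γ u` of `u ∈ L²(γ)`: it has finite
total variation and `∫ g d⟨D, h⟩ = - ∫ u ∂*_h g dγ` for all directions `h` and all test
functions `g`. -/
structure IsMeasureDeriv {n : ℕ} (u : EuclideanSpace ℝ (Fin n) → ℝ)
    (D : VectorMeasure (EuclideanSpace ℝ (Fin n)) (EuclideanSpace ℝ (Fin n))) : Prop where
  memLp : MemLp u 2 (γ n)
  finite_variation : IsFiniteMeasure D.variation
  integral_eq : ∀ (h : EuclideanSpace ℝ (Fin n)) (g : EuclideanSpace ℝ (Fin n) → ℝ),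
    IsTestFunction g → ∫ᵛ x, g x ∂•(component D h) = - ∫ x, u x * adjDeriv h g x ∂(γ n)

open Classical in
/-- The measure-derivative `D_γ u` of a function `u` of bounded variation with respect to `γ`
(and `0` if `u` is not of bounded variation). -/
def measureDeriv {n : ℕ} (u : EuclideanSpace ℝ (Fin n) → ℝ) :
    VectorMeasure (EuclideanSpace ℝ (Fin n)) (EuclideanSpace ℝ (Fin n)) :=
  if hu : ∃ D, IsMeasureDeriv u D then hu.choose else 0

/-- The Gaussian perimeter measure `|D_γ I_E|` of a set `E`; its total mass is the Gaussian
perimeter `P_γ(E)`. -/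
def perimeterMeasure {n : ℕ} (E : Set (EuclideanSpace ℝ (Fin n))) :
    Measure (EuclideanSpace ℝ (Fin n)) :=
  (measureDeriv (E.indicator fun _ => (1 : ℝ))).variation

/-- `γ(B | W_n = 0) = |D_γ I_{W_n > 0}|(B) / P_γ{W_n > 0}`. -/
def condProbTerminalZero (n : ℕ) (B : Set (EuclideanSpace ℝ (Fin n))) : ℝ :=
  (perimeterMeasure {x | 0 < W n n x}).real B /
    (perimeterMeasure {x | 0 < W n n x}).real Set.univ

end GaussianWalk

end

/-! For part one, split a path at the time `k` of its maximum. Reversing and negating the steps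
before `k` preserves the law, so the maximum is at time `k` with probability `p k * p (n - k)`,
where `p n = γ n (A n)`. Ties being negligible, these numbers sum to `1`; hence the generating
function of `p` squares to `1 / (1 - t)`, and `p n = centralBinom n / 4 ^ n`.

For the conditional probability, integrate `∂_h` by parts along lines parallel to `h`: `γ n` is
the product of its marginals on the hyperplane orthogonal to `h` and on the line spanned by `h`. The
derivative of the indicator of a half-space is thus a multiple of the Gaussian measure of the
bounding hyperplane, here the law of a walk conditioned to return to `0`. This law is invariant
under cyclic shifts of the steps, so the maximum is equally likely to be at each of the times
`0, …, n - 1`, and it is at time `0` exactly on `A n`. -/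

noncomputable section

namespace GaussianWalk

section CentralBinomial

open Finset

theorem two_mul_sum_antidiagonal_fst_mul {R : Type*} [CommSemiring R] (f : ℕ → R) (n : ℕ) :
    2 * ∑ p ∈ antidiagonal n, (p.1 : R) * (f p.1 * f p.2) =
      n * ∑ p ∈ antidiagonal n, f p.1 * f p.2 := by
  have hswap : ∑ p ∈ antidiagonal n, (p.1 : R) * (f p.1 * f p.2) =
      ∑ p ∈ antidiagonal n, (p.2 : R) * (f p.1 * f p.2) := by
    rw [← Nat.sum_antidiagonal_swap]
    exact sum_congr rfl fun p _ => by rw [Prod.fst_swap, Prod.snd_swap, mul_comm (f p.2)]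
  rw [two_mul]
  nth_rw 2 [hswap]
  rw [← sum_add_distrib, mul_sum]
  refine sum_congr rfl fun p hp => ?_
  rw [← add_mul, ← Nat.cast_add, mem_antidiagonal.1 hp]

/-- Weighting the convolution by the first index turns the ratio of consecutive central binomial
coefficients into a recursion. -/
theorem sum_antidiagonal_centralBinom_mul_centralBinom (n : ℕ) :
    ∑ p ∈ antidiagonal n, p.1.centralBinom * p.2.centralBinom = 4 ^ n := by
  induction n with
  | zero => simp
  | succ n ih =>
    have hshift : ∑ p ∈ antidiagonal (n + 1), p.1 * (p.1.centralBinom * p.2.centralBinom) =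
        ∑ p ∈ antidiagonal n, (2 * (2 * p.1 + 1)) * (p.1.centralBinom * p.2.centralBinom) := by
      rw [Nat.sum_antidiagonal_succ, zero_mul, zero_add]
      exact sum_congr rfl fun p _ => by
        rw [← mul_assoc, Nat.succ_mul_centralBinom_succ, mul_assoc]
    have hn := two_mul_sum_antidiagonal_fst_mul Nat.centralBinom n
    have hsucc := two_mul_sum_antidiagonal_fst_mul Nat.centralBinom (n + 1)
    simp only [Nat.cast_id] at hn hsucc
    have hsplit : ∑ p ∈ antidiagonal n,
        (2 * (2 * p.1 + 1)) * (p.1.centralBinom * p.2.centralBinom) =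
          2 * (2 * ∑ p ∈ antidiagonal n, p.1 * (p.1.centralBinom * p.2.centralBinom)) +
            2 * ∑ p ∈ antidiagonal n, p.1.centralBinom * p.2.centralBinom := by
      simp only [mul_sum, ← sum_add_distrib]
      exact sum_congr rfl fun p _ => by ring
    rw [hshift, hsplit, hn, ih] at hsucc
    refine Nat.eq_of_mul_eq_mul_left n.succ_pos ?_
    rw [Nat.succ_eq_add_one, ← hsucc]
    ring

theorem eq_of_sum_antidiagonal_mul_self_eq {R : Type*} [CommRing R] [NoZeroDivisors R] [CharZero R]
    {f g : ℕ → R} (hf : f 0 ≠ 0) (h0 : f 0 = g 0)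
    (h : ∀ n, ∑ p ∈ antidiagonal n, f p.1 * f p.2 = ∑ p ∈ antidiagonal n, g p.1 * g p.2) :
    f = g := by
  have hsq : PowerSeries.mk f ^ 2 = PowerSeries.mk g ^ 2 := by
    ext n
    simpa only [sq, PowerSeries.coeff_mul, PowerSeries.coeff_mk] using h n
  rcases sq_eq_sq_iff_eq_or_eq_neg.1 hsq with heq | hneg
  · ext n
    simpa only [PowerSeries.coeff_mk] using congrArg (PowerSeries.coeff n) heq
  · have hf0 : f 0 = -f 0 := by
      simpa only [map_neg, PowerSeries.coeff_mk, ← h0] using congrArg (PowerSeries.coeff 0) hneg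
    exact absurd (self_eq_neg.1 hf0) hf

theorem eq_centralBinom_div_four_pow {K : Type*} [Field K] [CharZero K] {p : ℕ → K} (h0 : p 0 = 1)
    (h : ∀ n, ∑ i ∈ antidiagonal n, p i.1 * p i.2 = 1) (n : ℕ) :
    p n = n.centralBinom / 4 ^ n := by
  refine congrFun (eq_of_sum_antidiagonal_mul_self_eq (g := fun n => (n.centralBinom : K) / 4 ^ n)
    (by simp [h0]) (by simp [h0]) fun n => ?_) n
  have hsum : ∑ i ∈ antidiagonal n, (i.1.centralBinom : K) * i.2.centralBinom = 4 ^ n := by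
    exact_mod_cast sum_antidiagonal_centralBinom_mul_centralBinom n
  rw [h, sum_congr rfl fun i hi => ?_, ← sum_div, hsum,
    div_self (mod_cast pow_ne_zero n four_ne_zero)]
  rw [div_mul_div_comm, ← pow_add, mem_antidiagonal.1 hi]

end CentralBinomial

section Walk

variable {n : ℕ}

theorem W_eq_sum_ite (n k : ℕ) (x : EuclideanSpace ℝ (Fin n)) :
    W n k x = ∑ i : Fin n, if i.val < k then x i else 0 := by
  rw [W, Finset.sum_filter]

theorem W_zero (x : EuclideanSpace ℝ (Fin n)) : W n 0 x = 0 := by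
  simp [W]

theorem W_of_le {k : ℕ} (h : n ≤ k) (x : EuclideanSpace ℝ (Fin n)) : W n k x = W n n x :=
  Finset.sum_congr (Finset.filter_congr fun i _ => by omega) fun _ _ => rfl

@[fun_prop]
theorem measurable_W (n k : ℕ) : Measurable (W n k) := by
  unfold W
  fun_prop

/-- The vector representing the linear form `W n k`. -/
def walkVector (n k : ℕ) : EuclideanSpace ℝ (Fin n) :=
  WithLp.toLp 2 fun i => if i.val < k then 1 else 0

theorem inner_walkVector (n k : ℕ) (x : EuclideanSpace ℝ (Fin n)) :
    inner ℝ (walkVector n k) x = W n k x := by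
  simp [W_eq_sum_ite, walkVector, PiLp.inner_apply]

/-- The set of walks whose maximum over the times `0, …, n` is attained at time `j`. -/
def maxAt (n j : ℕ) : Set (EuclideanSpace ℝ (Fin n)) :=
  {x | ∀ k ≤ n, W n k x ≤ W n j x}

theorem maxAt_zero (n : ℕ) : maxAt n 0 = A n := by
  simp only [maxAt, A, W_zero]

theorem measurableSet_maxAt (n j : ℕ) : MeasurableSet (maxAt n j) := by
  simp only [maxAt, Set.ofPred_forall]
  exact .iInter fun k => .iInter fun _ => measurableSet_le (measurable_W n k) (measurable_W n j)

theorem measurableSet_A (n : ℕ) : MeasurableSet (A n) :=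
  maxAt_zero n ▸ measurableSet_maxAt n 0

theorem exists_mem_maxAt (x : EuclideanSpace ℝ (Fin n)) :
    ∃ j ∈ Finset.range (n + 1), x ∈ maxAt n j := by
  obtain ⟨j, hj, hmax⟩ := Finset.exists_max_image (Finset.range (n + 1)) (fun k => W n k x)
    Finset.nonempty_range_add_one
  exact ⟨j, hj, fun k hk => hmax k (Finset.mem_range_succ_iff.2 hk)⟩

theorem sum_measureReal_maxAt {μ : Measure (EuclideanSpace ℝ (Fin n))} [IsProbabilityMeasure μ]
    {s : Finset ℕ} (hs : ∀ j ∈ s, j ≤ n)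
    (hties : ∀ i ∈ s, ∀ j ∈ s, i < j → μ {x | W n i x = W n j x} = 0)
    (hmax : ∀ᵐ x ∂μ, ∃ j ∈ s, x ∈ maxAt n j) : ∑ j ∈ s, μ.real (maxAt n j) = 1 := by
  have hinter : ∀ i ∈ s, ∀ j ∈ s, i < j → μ (maxAt n i ∩ maxAt n j) = 0 := fun i hi j hj hij =>
    measure_mono_null (fun x hx => le_antisymm (hx.2 i (hs i hi)) (hx.1 j (hs j hj)))
      (hties i hi j hj hij)
  have hdisj : Set.Pairwise ↑s (Function.onFun (AEDisjoint μ) (maxAt n)) := fun i hi j hj hij =>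
    hij.lt_or_gt.elim (hinter i hi j hj) fun hji => AEDisjoint.symm (hinter j hj i hi hji)
  rw [← measureReal_biUnion_finset₀ hdisj fun j _ => (measurableSet_maxAt n j).nullMeasurableSet]
  have huniv : ⋃ j ∈ s, maxAt n j =ᵐ[μ] Set.univ := Filter.eventuallyEq_univ.2 <| by
    filter_upwards [hmax] with x hx
    simpa only [Set.mem_iUnion, exists_prop] using hx
  rw [measureReal_congr huniv, probReal_univ]

end Walk

section IIDLaw

variable {k m n : ℕ} {α : Type*} [MeasurableSpace α]

theorem measurePreserving_append (ν : Fin (k + m) → Measure α) [∀ i, SigmaFinite (ν i)] :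
    MeasurePreserving (fun p : (Fin k → α) × (Fin m → α) => Fin.append p.1 p.2)
      ((Measure.pi fun i => ν (Fin.castAdd m i)).prod (Measure.pi fun i => ν (Fin.natAdd k i)))
      (Measure.pi ν) := by
  have hmeas : Measurable fun p : (Fin k → α) × (Fin m → α) => Fin.append p.1 p.2 := by
    refine measurable_pi_lambda _ fun i => ?_
    cases i using Fin.addCases with
    | left i => simp only [Fin.append_left]; fun_prop
    | right i => simp only [Fin.append_right]; fun_prop
  refine ⟨hmeas, (Measure.pi_eq fun s hs => ?_).symm⟩
  have hpre : (fun p : (Fin k → α) × (Fin m → α) => Fin.append p.1 p.2) ⁻¹' Set.univ.pi s =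
      (Set.univ.pi fun i => s (Fin.castAdd m i)) ×ˢ (Set.univ.pi fun i => s (Fin.natAdd k i)) := by
    ext p
    simp only [Set.mem_preimage, Set.mem_univ_pi, Set.mem_prod, Fin.forall_fin_add,
      Fin.append_left, Fin.append_right]
  rw [Measure.map_apply hmeas (MeasurableSet.univ_pi hs), hpre, Measure.prod_prod, Measure.pi_pi,
    Measure.pi_pi, Fin.prod_univ_add]

theorem measurePreserving_neg_rev (ν : Measure ℝ) [SigmaFinite ν] [ν.IsNegInvariant] (k : ℕ) :
    MeasurePreserving (fun (x : Fin k → ℝ) i => -x (Fin.rev i))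
      (Measure.pi fun _ => ν) (Measure.pi fun _ => ν) := by
  convert (Measure.measurePreserving_neg (Measure.pi fun _ : Fin k => ν)).comp
    (measurePreserving_piCongrLeft (fun _ : Fin k => ν) Fin.revPerm) using 1
  ext x i
  have hrev := MeasurableEquiv.piCongrLeft_apply_apply (β := fun _ : Fin k => ℝ) Fin.revPerm x
    (Fin.rev i)
  rw [Fin.revPerm_apply, Fin.rev_rev] at hrev
  simp only [Function.comp_apply, Pi.neg_apply, hrev]

theorem W_append (j : ℕ) (x : Fin k → ℝ) (y : Fin m → ℝ) :
    W (k + m) j (WithLp.toLp 2 (Fin.append x y)) =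
      W k j (WithLp.toLp 2 x) + W m (j - k) (WithLp.toLp 2 y) := by
  simp only [W_eq_sum_ite, Fin.sum_univ_add, Fin.append_left, Fin.append_right, Fin.val_castAdd,
    Fin.val_natAdd, Nat.lt_sub_iff_add_lt']

theorem W_neg_rev {j : ℕ} (hj : j ≤ k) (x : Fin k → ℝ) :
    W k j (WithLp.toLp 2 fun i => -x (Fin.rev i)) =
      W k (k - j) (WithLp.toLp 2 x) - W k k (WithLp.toLp 2 x) := by
  simp only [W_eq_sum_ite, ← Finset.sum_sub_distrib]
  rw [← Equiv.sum_comp Fin.revPerm]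
  refine Finset.sum_congr rfl fun i _ => ?_
  have hiff : k - (i.val + 1) < j ↔ ¬i.val < k - j := by omega
  by_cases h : i.val < k - j <;>
    simp [hiff, h]

/-- Reversing and negating the steps before time `k` turns the excursion below the level at time
`k` into a walk starting at `0`. -/
theorem append_neg_rev_mem_maxAt_iff (x : Fin k → ℝ) (y : Fin m → ℝ) :
    WithLp.toLp 2 (Fin.append (fun i => -x (Fin.rev i)) y) ∈ maxAt (k + m) k ↔
      WithLp.toLp 2 x ∈ A k ∧ WithLp.toLp 2 y ∈ A m := by
  set z := WithLp.toLp 2 (Fin.append (fun i => -x (Fin.rev i)) y)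
  have hbefore {j : ℕ} (hj : j ≤ k) :
      W (k + m) (k - j) z = W k j (WithLp.toLp 2 x) - W k k (WithLp.toLp 2 x) := by
    rw [W_append, W_neg_rev (Nat.sub_le k j), Nat.sub_sub_self hj,
      Nat.sub_eq_zero_of_le (Nat.sub_le k j), W_zero, add_zero]
  have hafter (j : ℕ) :
      W (k + m) (k + j) z = W m j (WithLp.toLp 2 y) - W k k (WithLp.toLp 2 x) := by
    rw [W_append, W_of_le (Nat.le_add_right k j), W_neg_rev le_rfl, Nat.sub_self, W_zero,
      Nat.add_sub_cancel_left]
    ring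
  have hk : W (k + m) k z = -W k k (WithLp.toLp 2 x) := by
    simpa only [add_zero, W_zero, zero_sub] using hafter 0
  simp only [maxAt, A, Set.mem_ofPred_eq, hk]
  refine ⟨fun h => ⟨fun j hj => ?_, fun j hj => ?_⟩, fun ⟨hx, hy⟩ j hj => ?_⟩
  · linarith [h (k - j) (by omega), hbefore hj]
  · linarith [h (k + j) (by omega), hafter j]
  · rcases le_total j k with hjk | hjk
    · have := hbefore (Nat.sub_le k j)
      rw [Nat.sub_sub_self hjk] at this
      linarith [hx (k - j) (Nat.sub_le k j)]
    · obtain ⟨i, rfl⟩ := Nat.exists_eq_add_of_le hjk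
      linarith [hy i (by omega), hafter i]

/-- The law on `ℝⁿ` of `n` independent real random variables with law `ν`. -/
def iidLaw (ν : Measure ℝ) (n : ℕ) : Measure (EuclideanSpace ℝ (Fin n)) :=
  (Measure.pi fun _ => ν).map (WithLp.toLp 2)

variable {ν : Measure ℝ} [IsProbabilityMeasure ν]

theorem iidLaw_gaussianReal (n : ℕ) : iidLaw (gaussianReal 0 1) n = γ n :=
  map_pi_eq_stdGaussian

theorem measurePreserving_toLp_iidLaw (ν : Measure ℝ) (n : ℕ) :
    MeasurePreserving (WithLp.toLp 2) (Measure.pi fun _ : Fin n => ν) (iidLaw ν n) :=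
  ⟨by fun_prop, rfl⟩

instance isProbabilityMeasure_iidLaw : IsProbabilityMeasure (iidLaw ν n) :=
  Measure.isProbabilityMeasure_map (by fun_prop)

theorem iidLaw_real_maxAt [ν.IsNegInvariant] (k m : ℕ) :
    (iidLaw ν (k + m)).real (maxAt (k + m) k) =
      (iidLaw ν k).real (A k) * (iidLaw ν m).real (A m) := by
  have hsplit := (measurePreserving_toLp_iidLaw ν (k + m)).comp
    ((measurePreserving_append fun _ => ν).comp
      ((measurePreserving_neg_rev ν k).prod (MeasurePreserving.id (Measure.pi fun _ : Fin m => ν))))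
  rw [← hsplit.measureReal_preimage (measurableSet_maxAt (k + m) k).nullMeasurableSet,
    ← (measurePreserving_toLp_iidLaw ν k).measureReal_preimage
      (measurableSet_A k).nullMeasurableSet,
    ← (measurePreserving_toLp_iidLaw ν m).measureReal_preimage
      (measurableSet_A m).nullMeasurableSet,
    ← measureReal_prod_prod]
  congr 1
  ext p
  exact append_neg_rev_mem_maxAt_iff p.1 p.2

theorem pi_setOf_sum_mul_eq_eq_zero (ν : Fin n → Measure ℝ) [∀ i, SigmaFinite (ν i)] {i₀ : Fin n}
    [NullSingletonClass (ν i₀)] {a : Fin n → ℝ} (ha : a i₀ ≠ 0) (c : ℝ) :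
    Measure.pi ν {x | ∑ i, a i * x i = c} = 0 := by
  cases n with
  | zero => exact i₀.elim0
  | succ n =>
    set H : Set (ℝ × (Fin n → ℝ)) := {p | a i₀ * p.1 + ∑ i, a (i₀.succAbove i) * p.2 i = c}
    have hH : MeasurableSet H := measurableSet_eq_fun (by fun_prop) (by fun_prop)
    have hpre : {x | ∑ i, a i * x i = c} =
        MeasurableEquiv.piFinSuccAbove (fun _ => ℝ) i₀ ⁻¹' H := by
      ext x
      simp [H, Fin.sum_univ_succAbove _ i₀, Fin.removeNth]
    rw [hpre, (measurePreserving_piFinSuccAbove ν i₀).measure_preimage hH.nullMeasurableSet,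
      Measure.prod_apply_symm hH]
    have hslice (y : Fin n → ℝ) : ν i₀ ((fun t => (t, y)) ⁻¹' H) = 0 := by
      refine Set.Subsingleton.measure_zero (fun s hs t ht => mul_left_cancel₀ ha ?_) (ν i₀)
      rw [Set.mem_preimage, Set.mem_ofPred_eq] at hs ht
      linarith
    simp only [hslice, lintegral_zero]

theorem iidLaw_setOf_W_eq_W [NullSingletonClass ν] {i j : ℕ} (hij : i < j) (hj : j ≤ n) :
    iidLaw ν n {x | W n i x = W n j x} = 0 := by
  have hmeas : MeasurableSet {x | W n i x = W n j x} :=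
    measurableSet_eq_fun (measurable_W n i) (measurable_W n j)
  have hpre : WithLp.toLp 2 ⁻¹' {x | W n i x = W n j x} =
      {x | ∑ l, walkVector n i l * x l - ∑ l, walkVector n j l * x l = 0} := by
    ext x
    simp only [Set.mem_preimage, Set.mem_ofPred_eq, sub_eq_zero, ← inner_walkVector,
      PiLp.inner_apply, RCLike.inner_apply, conj_trivial, mul_comm]
  rw [← (measurePreserving_toLp_iidLaw ν n).measure_preimage hmeas.nullMeasurableSet, hpre]
  simp only [← Finset.sum_sub_distrib, ← sub_mul]
  exact pi_setOf_sum_mul_eq_eq_zero _ (i₀ := ⟨i, hij.trans_le hj⟩) (by simp [walkVector, hij]) 0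

/-- The Sparre Andersen identity: the walk attains its maximum at time `k` with probability
`p k * p (n - k)`, where `p n = iidLaw ν n (A n)`, whence the `p n` convolve with themselves
to `1`. -/
theorem iidLaw_real_A [NullSingletonClass ν] [ν.IsNegInvariant] (n : ℕ) :
    (iidLaw ν n).real (A n) = n.centralBinom / 4 ^ n := by
  refine eq_centralBinom_div_four_pow (p := fun n => (iidLaw ν n).real (A n)) ?_ (fun n => ?_) n
  · have huniv : A 0 = Set.univ := Set.eq_univ_of_forall fun x k _ => by simp [W]
    simp only [huniv, probReal_univ]
  · rw [← sum_measureReal_maxAt (μ := iidLaw ν n) (s := Finset.range (n + 1))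
      (fun j hj => Finset.mem_range_succ_iff.1 hj)
      (fun i _ j hj hij => iidLaw_setOf_W_eq_W hij (Finset.mem_range_succ_iff.1 hj))
      (.of_forall exists_mem_maxAt), ← Finset.Nat.sum_antidiagonal_eq_sum_range_succ_mk
        fun p => (iidLaw ν n).real (maxAt n p.1)]
    refine Finset.sum_congr rfl fun p hp => ?_
    obtain rfl := Finset.HasAntidiagonal.mem_antidiagonal.1 hp
    exact (iidLaw_real_maxAt p.1 p.2).symm

theorem stdGaussian_real_A (n : ℕ) : (γ n).real (A n) = n.centralBinom / 4 ^ n := by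
  have : NullSingletonClass (gaussianReal 0 1) := nullSingletonClass_gaussianReal one_ne_zero
  have : (gaussianReal 0 1).IsNegInvariant := ⟨by
    rw [Measure.neg, gaussianReal_map_neg, neg_zero]⟩
  rw [← iidLaw_gaussianReal, iidLaw_real_A]

end IIDLaw

section CyclicShift

variable {n : ℕ}

/-- The isometry `(x₁, …, xₙ) ↦ (x₂, …, xₙ, x₁)`. -/
def cyclicShift (n : ℕ) : EuclideanSpace ℝ (Fin n) ≃ₗᵢ[ℝ] EuclideanSpace ℝ (Fin n) :=
  LinearIsometryEquiv.piLpCongrLeft 2 ℝ ℝ (finRotate n).symm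

theorem cyclicShift_apply (x : EuclideanSpace ℝ (Fin n)) (i : Fin n) :
    cyclicShift n x i = x (finRotate n i) := by
  simp [cyclicShift, LinearIsometryEquiv.piLpCongrLeft_apply, Equiv.piCongrLeft']

theorem W_cyclicShift {k : ℕ} (hk : k < n) (x : EuclideanSpace ℝ (Fin n)) :
    W n k (cyclicShift n x) = W n (k + 1) x - W n 1 x := by
  cases n with
  | zero => exact absurd hk k.not_lt_zero
  | succ n =>
    simp only [W_eq_sum_ite, cyclicShift_apply, ← Finset.sum_sub_distrib]
    rw [← Equiv.sum_comp (finRotate (n + 1)) fun i : Fin (n + 1) =>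
      (if i.val < k + 1 then x i else 0) - if i.val < 1 then x i else 0]
    refine Finset.sum_congr rfl fun i _ => ?_
    cases i using Fin.lastCases with
    | last => simp [Nat.lt_succ_iff.1 hk]
    | cast i => simp

theorem W_self_cyclicShift (x : EuclideanSpace ℝ (Fin n)) :
    W n n (cyclicShift n x) = W n n x := by
  simp only [W_eq_sum_ite, cyclicShift_apply, Fin.is_lt, if_true]
  exact Equiv.sum_comp (finRotate n) fun i => x i

theorem cyclicShift_mem_maxAt_iff {j : ℕ} (hj : j < n) {x : EuclideanSpace ℝ (Fin n)}
    (hx : W n n x = 0) : cyclicShift n x ∈ maxAt n j ↔ x ∈ maxAt n (j + 1) := by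
  simp only [maxAt, Set.mem_ofPred_eq, W_cyclicShift hj]
  refine ⟨fun h k hk => ?_, fun h k hk => ?_⟩
  · cases k with
    | zero =>
      have hlast := h (n - 1) (Nat.sub_le n 1)
      rw [W_cyclicShift (by omega), Nat.sub_add_cancel (by omega), hx] at hlast
      linarith [W_zero x]
    | succ k => linarith [h k (by omega), W_cyclicShift hk x]
  · rcases hk.lt_or_eq with hlt | rfl
    · linarith [h (k + 1) hlt, W_cyclicShift hlt x]
    · linarith [h 1 (by omega), W_self_cyclicShift x]

variable {μ : Measure (EuclideanSpace ℝ (Fin n))}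

theorem measureReal_maxAt_eq_measureReal_A (hshift : MeasurePreserving (cyclicShift n) μ μ)
    (hbridge : ∀ᵐ x ∂μ, W n n x = 0) {j : ℕ} (hj : j ≤ n) :
    μ.real (maxAt n j) = μ.real (A n) := by
  induction j with
  | zero => rw [maxAt_zero]
  | succ j ih =>
    rw [← ih (by omega),
      ← hshift.measureReal_preimage (measurableSet_maxAt n j).nullMeasurableSet]
    refine measureReal_congr ?_
    filter_upwards [hbridge] with x hx
    exact propext (cyclicShift_mem_maxAt_iff hj hx).symm

theorem measureReal_A_eq_one_div [IsProbabilityMeasure μ] (hn : n ≠ 0)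
    (hshift : MeasurePreserving (cyclicShift n) μ μ) (hbridge : ∀ᵐ x ∂μ, W n n x = 0)
    (hties : ∀ i j, i < j → j < n → μ {x | W n i x = W n j x} = 0) :
    μ.real (A n) = 1 / n := by
  have hmax : ∀ᵐ x ∂μ, ∃ j ∈ Finset.range n, x ∈ maxAt n j := by
    filter_upwards [hbridge] with x hx
    obtain ⟨j, hj, hxj⟩ := exists_mem_maxAt x
    rcases (Finset.mem_range_succ_iff.1 hj).lt_or_eq with hlt | rfl
    · exact ⟨j, Finset.mem_range.2 hlt, hxj⟩
    · exact ⟨0, Finset.mem_range.2 (Nat.pos_of_ne_zero hn), fun k hk => by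
        rw [W_zero, ← hx]; exact hxj k hk⟩
  have hsum := sum_measureReal_maxAt (fun j hj => (Finset.mem_range.1 hj).le)
    (fun i _ j hj hij => hties i j hij (Finset.mem_range.1 hj)) hmax
  rw [Finset.sum_congr rfl fun j hj =>
      measureReal_maxAt_eq_measureReal_A hshift hbridge (Finset.mem_range.1 hj).le,
    Finset.sum_const, Finset.card_range, nsmul_eq_mul] at hsum
  rwa [eq_div_iff (Nat.cast_ne_zero.2 hn), mul_comm]

end CyclicShift

section HyperplaneGaussian

open scoped InnerProductSpace

variable {E : Type*} [NormedAddCommGroup E] [InnerProductSpace ℝ E] [FiniteDimensional ℝ E]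
  [MeasurableSpace E] [BorelSpace E]

theorem stdGaussian_setOf_inner_eq_zero {v : E} (hv : v ≠ 0) :
    stdGaussian E {x | ⟪v, x⟫_ℝ = 0} = 0 := by
  have hmap : (stdGaussian E).map (innerSL ℝ v) = gaussianReal 0 (‖v‖₊ ^ 2) := by
    rw [IsGaussian.map_eq_gaussianReal, variance_dual_stdGaussian, integral_strongDual_stdGaussian,
      innerSL_apply_norm]
    congr 1
    ext
    simp
  have := nullSingletonClass_gaussianReal (μ := 0) (pow_ne_zero 2 (nnnorm_ne_zero_iff.2 hv))
  have hzero : (stdGaussian E).map (innerSL ℝ v) {0} = 0 := by rw [hmap, measure_singleton]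
  rwa [Measure.map_apply (by fun_prop) (measurableSet_singleton 0)] at hzero

/-- The standard Gaussian measure of the hyperplane orthogonal to `w`, as a measure on the ambient
space. -/
def hyperplaneGaussian (w : E) : Measure E :=
  (stdGaussian E).map (ℝ ∙ w)ᗮ.starProjection

variable {v w : E}

instance isProbabilityMeasure_hyperplaneGaussian :
    IsProbabilityMeasure (hyperplaneGaussian w) :=
  Measure.isProbabilityMeasure_map (by fun_prop)

theorem ae_hyperplaneGaussian_inner_eq_zero (w : E) :
    ∀ᵐ x ∂(hyperplaneGaussian w), ⟪w, x⟫_ℝ = 0 := by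
  rw [hyperplaneGaussian, ae_map_iff (by fun_prop)
    (measurableSet_eq_fun (by fun_prop) measurable_const)]
  exact .of_forall fun x => Submodule.mem_orthogonal_singleton_iff_inner_right.1
    (Submodule.starProjection_apply_mem _ x)

theorem hyperplaneGaussian_setOf_inner_eq_zero (hv : v ∉ ℝ ∙ w) :
    hyperplaneGaussian w {x | ⟪v, x⟫_ℝ = 0} = 0 := by
  rw [hyperplaneGaussian, Measure.map_apply (by fun_prop)
    (measurableSet_eq_fun (by fun_prop) measurable_const)]
  simp only [Set.preimage_ofPred_eq, ← Submodule.inner_starProjection_left_eq_right]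
  refine stdGaussian_setOf_inner_eq_zero fun hproj => hv ?_
  rwa [Submodule.starProjection_apply_eq_zero_iff, Submodule.orthogonal_orthogonal] at hproj

theorem measurePreserving_hyperplaneGaussian {F : Type*} [NormedAddCommGroup F]
    [InnerProductSpace ℝ F] [FiniteDimensional ℝ F] [MeasurableSpace F] [BorelSpace F]
    (f : E ≃ₗᵢ[ℝ] F) (w : E) :
    MeasurePreserving f (hyperplaneGaussian w) (hyperplaneGaussian (f w)) := by
  refine ⟨by fun_prop, ?_⟩
  have hcomm : f ∘ (ℝ ∙ w)ᗮ.starProjection = (ℝ ∙ f w)ᗮ.starProjection ∘ f := by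
    ext x
    simp [Submodule.starProjection_orthogonal_val, Submodule.starProjection_singleton]
  rw [hyperplaneGaussian, Measure.map_map (by fun_prop) (by fun_prop), hcomm,
    ← Measure.map_map (by fun_prop) (by fun_prop), stdGaussian_map, hyperplaneGaussian]

theorem charFun_hyperplaneGaussian (w t : E) :
    charFun (hyperplaneGaussian w) t = Complex.exp (-‖(ℝ ∙ w)ᗮ.starProjection t‖ ^ 2 / 2) := by
  rw [hyperplaneGaussian, charFun_apply, integral_map (by fun_prop) (by fun_prop)]
  simp only [Submodule.inner_starProjection_left_eq_right]
  rw [← charFun_apply, charFun_stdGaussian]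

theorem charFun_map_gaussianReal_smul (v : NNReal) (w t : E) :
    charFun ((gaussianReal 0 v).map (· • w)) t = Complex.exp (-(v * ⟪w, t⟫_ℝ ^ 2) / 2) := by
  rw [charFun_apply, integral_map (by fun_prop) (by fun_prop)]
  simp only [real_inner_smul_left, mul_comm _ ⟪w, t⟫_ℝ]
  have h := charFun_gaussianReal (μ := 0) (v := v) ⟪w, t⟫_ℝ
  rw [charFun_apply_real] at h
  push_cast
  rw [h]
  congr 1
  push_cast
  ring

theorem hyperplaneGaussian_conv_eq_stdGaussian {w : E} (hw : w ≠ 0) :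
    hyperplaneGaussian w ∗ (gaussianReal 0 (‖w‖₊ ^ 2)⁻¹).map (· • w) = stdGaussian E := by
  have : IsProbabilityMeasure ((gaussianReal 0 (‖w‖₊ ^ 2)⁻¹).map (· • w)) :=
    Measure.isProbabilityMeasure_map (by fun_prop)
  refine Measure.ext_of_charFun (funext fun t => ?_)
  have hpyth := Submodule.norm_sq_eq_add_norm_sq_starProjection t (ℝ ∙ w)
  rw [charFun_conv, charFun_hyperplaneGaussian, charFun_map_gaussianReal_smul,
    charFun_stdGaussian, ← Complex.exp_add]
  congr 1
  have hw' : ‖w‖ ≠ 0 := norm_ne_zero_iff.2 hw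
  have hproj : ‖(ℝ ∙ w).starProjection t‖ ^ 2 = (‖w‖ ^ 2)⁻¹ * ⟪w, t⟫_ℝ ^ 2 := by
    rw [Submodule.starProjection_singleton, norm_smul, mul_pow, Real.norm_eq_abs, sq_abs]
    simp only [RCLike.ofReal_real_eq_id, id]
    field_simp
  rw [hproj] at hpyth
  norm_cast
  push_cast
  rw [hpyth]
  ring

end HyperplaneGaussian

section Bridge

variable {n : ℕ}

theorem cyclicShift_walkVector_self (n : ℕ) : cyclicShift n (walkVector n n) = walkVector n n := by
  ext i
  simp [cyclicShift_apply, walkVector]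

theorem walkVector_sub_walkVector_notMem_span {i j : ℕ} (hij : i < j) (hj : j < n) :
    walkVector n i - walkVector n j ∉ ℝ ∙ walkVector n n := by
  rw [Submodule.mem_span_singleton]
  rintro ⟨c, hc⟩
  have hneg : c = -1 := by
    simpa [walkVector, hij, hij.trans hj] using
      congrArg (fun v : EuclideanSpace ℝ (Fin n) => v ⟨i, hij.trans hj⟩) hc
  have hzero : c = 0 := by
    simpa [walkVector, hij.not_gt, hj] using
      congrArg (fun v : EuclideanSpace ℝ (Fin n) => v ⟨j, hj⟩) hc
  linarith

theorem hyperplaneGaussian_real_A (hn : n ≠ 0) :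
    (hyperplaneGaussian (walkVector n n)).real (A n) = 1 / n := by
  refine measureReal_A_eq_one_div hn ?_ ?_ fun i j hij hj => ?_
  · simpa only [cyclicShift_walkVector_self] using
      measurePreserving_hyperplaneGaussian (cyclicShift n) (walkVector n n)
  · simpa only [inner_walkVector] using ae_hyperplaneGaussian_inner_eq_zero (walkVector n n)
  · simpa only [inner_sub_left, inner_walkVector, sub_eq_zero] using
      hyperplaneGaussian_setOf_inner_eq_zero (walkVector_sub_walkVector_notMem_span hij hj)

end Bridge

section TestFunctions

variable {n : ℕ} {g : EuclideanSpace ℝ (Fin n) → ℝ}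

theorem isTestFunction_comp_inner {f : ℝ → ℝ} (hf : ContDiff ℝ (⊤ : ℕ∞) f)
    (hbound : ∀ k, ∃ C, ∀ x, |iteratedDeriv k f x| ≤ C) (t : EuclideanSpace ℝ (Fin n)) :
    IsTestFunction fun x => f (inner ℝ t x) := by
  refine ⟨hf.comp (innerSL ℝ t).contDiff, fun k => ?_⟩
  obtain ⟨C, hC⟩ := hbound k
  refine ⟨C * ∏ _i : Fin k, ‖innerSL ℝ t‖, fun x => ?_⟩
  change ‖iteratedFDeriv ℝ k (f ∘ innerSL ℝ t) x‖ ≤ _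
  rw [(innerSL ℝ t).iteratedFDeriv_comp_right hf x (mod_cast le_top)]
  refine (ContinuousMultilinearMap.norm_compContinuousLinearMap_le _ _).trans ?_
  rw [norm_iteratedFDeriv_eq_norm_iteratedDeriv]
  gcongr
  exact hC _

theorem isTestFunction_cos_inner (t : EuclideanSpace ℝ (Fin n)) :
    IsTestFunction fun x => Real.cos (inner ℝ t x) :=
  isTestFunction_comp_inner Real.contDiff_cos
    (fun k => ⟨1, Real.abs_iteratedDeriv_cos_le_one k⟩) t

theorem isTestFunction_sin_inner (t : EuclideanSpace ℝ (Fin n)) :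
    IsTestFunction fun x => Real.sin (inner ℝ t x) :=
  isTestFunction_comp_inner Real.contDiff_sin
    (fun k => ⟨1, Real.abs_iteratedDeriv_sin_le_one k⟩) t

theorem IsTestFunction.exists_norm_le (hg : IsTestFunction g) : ∃ C, ∀ x, ‖g x‖ ≤ C := by
  simpa only [norm_iteratedFDeriv_zero] using hg.bounded 0

theorem IsTestFunction.exists_norm_fderiv_le (hg : IsTestFunction g) :
    ∃ C, ∀ x, ‖fderiv ℝ g x‖ ≤ C := by
  simpa only [norm_iteratedFDeriv_one] using hg.bounded 1

theorem IsTestFunction.integrable (hg : IsTestFunction g)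
    (μ : Measure (EuclideanSpace ℝ (Fin n))) [IsFiniteMeasure μ] : Integrable g μ :=
  let ⟨C, hC⟩ := hg.exists_norm_le
  .of_bound hg.contDiff.continuous.aestronglyMeasurable C (.of_forall hC)

theorem measure_ext_of_isTestFunction {μ ν : Measure (EuclideanSpace ℝ (Fin n))}
    [IsFiniteMeasure μ] [IsFiniteMeasure ν]
    (h : ∀ g, IsTestFunction g → ∫ x, g x ∂μ = ∫ x, g x ∂ν) : μ = ν := by
  refine Measure.ext_of_charFun (funext fun t => ?_)
  have hcos := isTestFunction_cos_inner t
  have hsin := isTestFunction_sin_inner t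
  have hcharFun (ρ : Measure (EuclideanSpace ℝ (Fin n))) [IsFiniteMeasure ρ] :
      charFun ρ t = ((∫ x, Real.cos (inner ℝ t x) ∂ρ : ℝ) : ℂ) +
        ((∫ x, Real.sin (inner ℝ t x) ∂ρ : ℝ) : ℂ) * Complex.I := by
    rw [charFun_apply, ← integral_complex_ofReal, ← integral_complex_ofReal,
      ← integral_mul_const, ← integral_add (hcos.integrable ρ).ofReal
        ((hsin.integrable ρ).ofReal.mul_const _)]
    refine integral_congr_ae (.of_forall fun x => ?_)
    simp [Complex.exp_mul_I, real_inner_comm]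
  rw [hcharFun, hcharFun, h _ hcos, h _ hsin]

end TestFunctions

section VectorMeasure

variable {X : Type*} [MeasurableSpace X]

theorem vectorIntegral_toSignedMeasure (μ : Measure X) [IsFiniteMeasure μ] (f : X → ℝ) :
    ∫ᵛ x, f x ∂•μ.toSignedMeasure = ∫ x, f x ∂μ := by
  have hflip : (ContinuousLinearMap.lsmul ℝ ℝ : ℝ →L[ℝ] ℝ →L[ℝ] ℝ) =
      (ContinuousLinearMap.lsmul ℝ ℝ : ℝ →L[ℝ] ℝ →L[ℝ] ℝ).flip := by
    ext
    simp
  rw [hflip]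
  exact VectorMeasure.integral_toSignedMeasure

theorem vectorIntegral_eq_integral_posPart_sub_integral_negPart (s : SignedMeasure X) {f : X → ℝ}
    (hpos : Integrable f s.toJordanDecomposition.posPart)
    (hneg : Integrable f s.toJordanDecomposition.negPart) :
    ∫ᵛ x, f x ∂•s = ∫ x, f x ∂s.toJordanDecomposition.posPart -
      ∫ x, f x ∂s.toJordanDecomposition.negPart := by
  conv_lhs => rw [← s.toSignedMeasure_toJordanDecomposition, JordanDecomposition.toSignedMeasure]
  rw [VectorMeasure.integral_sub_vectorMeasure, vectorIntegral_toSignedMeasure,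
    vectorIntegral_toSignedMeasure]
  · simpa [VectorMeasure.Integrable] using hpos
  · simpa [VectorMeasure.Integrable] using hneg

theorem variation_withDensityᵥ_const {E : Type*} [NormedAddCommGroup E] [NormedSpace ℝ E]
    [CompleteSpace E] (ν : Measure X) [IsFiniteMeasure ν] (e : E) :
    (ν.withDensityᵥ fun _ => e).variation = ‖e‖ₑ • ν := by
  rw [Measure.variation_withDensityᵥ (integrable_const e), withDensity_const]

variable {n : ℕ}

theorem signedMeasure_ext_of_isTestFunction {s t : SignedMeasure (EuclideanSpace ℝ (Fin n))}
    (h : ∀ g : EuclideanSpace ℝ (Fin n) → ℝ, IsTestFunction g →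
      ∫ᵛ x, g x ∂•s = ∫ᵛ x, g x ∂•t) : s = t := by
  have hjordan : s.toJordanDecomposition.posPart + t.toJordanDecomposition.negPart =
      t.toJordanDecomposition.posPart + s.toJordanDecomposition.negPart := by
    refine measure_ext_of_isTestFunction fun g hg => ?_
    have hst := h g hg
    rw [vectorIntegral_eq_integral_posPart_sub_integral_negPart s (hg.integrable _)
        (hg.integrable _), vectorIntegral_eq_integral_posPart_sub_integral_negPart t
        (hg.integrable _) (hg.integrable _), sub_eq_sub_iff_add_eq_add] at hst
    rwa [integral_add_measure (hg.integrable _) (hg.integrable _),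
      integral_add_measure (hg.integrable _) (hg.integrable _)]
  have hsigned := Measure.toSignedMeasure_congr hjordan
  rw [Measure.toSignedMeasure_add, Measure.toSignedMeasure_add] at hsigned
  rw [← s.toSignedMeasure_toJordanDecomposition, ← t.toSignedMeasure_toJordanDecomposition,
    JordanDecomposition.toSignedMeasure, JordanDecomposition.toSignedMeasure,
    sub_eq_sub_iff_add_eq_add, hsigned]

end VectorMeasure

section MeasureDeriv

variable {n : ℕ} {u : EuclideanSpace ℝ (Fin n) → ℝ}
  {D D' : VectorMeasure (EuclideanSpace ℝ (Fin n)) (EuclideanSpace ℝ (Fin n))}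

theorem component_apply (D : VectorMeasure (EuclideanSpace ℝ (Fin n)) (EuclideanSpace ℝ (Fin n)))
    (h : EuclideanSpace ℝ (Fin n)) (s : Set (EuclideanSpace ℝ (Fin n))) :
    component D h s = inner ℝ h (D s) :=
  rfl

theorem IsMeasureDeriv.unique (hD : IsMeasureDeriv u D) (hD' : IsMeasureDeriv u D') : D = D' := by
  ext1 s _
  refine ext_inner_left ℝ fun h => ?_
  have hcomponent : component D h = component D' h :=
    signedMeasure_ext_of_isTestFunction fun g hg => by
      rw [hD.integral_eq h g hg, hD'.integral_eq h g hg]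
  rw [← component_apply, hcomponent, component_apply]

theorem IsMeasureDeriv.measureDeriv_eq (hD : IsMeasureDeriv u D) : measureDeriv u = D := by
  have hu : ∃ D, IsMeasureDeriv u D := ⟨D, hD⟩
  rw [measureDeriv, dif_pos hu]
  exact hu.choose_spec.unique hD

theorem component_withDensityᵥ_const (ν : Measure (EuclideanSpace ℝ (Fin n))) [IsFiniteMeasure ν]
    (e h : EuclideanSpace ℝ (Fin n)) :
    component (ν.withDensityᵥ fun _ => e) h = inner ℝ h e • ν.toSignedMeasure := by
  ext s hs
  rw [component_apply, withDensityᵥ_apply (integrable_const e) hs, setIntegral_const,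
    real_inner_smul_right, mul_comm, _root_.smul_apply,
    Measure.toSignedMeasure_apply_measurable hs, smul_eq_mul]

theorem vectorIntegral_component_withDensityᵥ_const (ν : Measure (EuclideanSpace ℝ (Fin n)))
    [IsFiniteMeasure ν] (e h : EuclideanSpace ℝ (Fin n)) (g : EuclideanSpace ℝ (Fin n) → ℝ) :
    ∫ᵛ x, g x ∂•(component (ν.withDensityᵥ fun _ => e) h) = inner ℝ h e * ∫ x, g x ∂ν := by
  rw [component_withDensityᵥ_const, VectorMeasure.integral_smul_vectorMeasure,
    vectorIntegral_toSignedMeasure, smul_eq_mul]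

end MeasureDeriv

section Stein

open scoped NNReal

open Filter

theorem hasDerivAt_gaussianPDFReal (μ : ℝ) (v : ℝ≥0) (t : ℝ) :
    HasDerivAt (gaussianPDFReal μ v) (-((t - μ) / v) * gaussianPDFReal μ v t) t := by
  rw [gaussianPDFReal_def]
  have hexp : HasDerivAt (fun x : ℝ => -(x - μ) ^ 2 / (2 * v)) (-((t - μ) / v)) t := by
    refine (((hasDerivAt_id t).sub_const μ).pow 2).neg.div_const (2 * (v : ℝ)) |>.congr_deriv ?_
    simp only [id, Nat.cast_ofNat, Nat.add_one_sub_one, pow_one, mul_one]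
    rw [← mul_neg, mul_div_mul_left _ _ two_ne_zero, neg_div]
  refine (hexp.exp.const_mul (√(2 * Real.pi * v))⁻¹).congr_deriv ?_
  ring

theorem tendsto_gaussianPDFReal_cocompact (μ : ℝ) {v : ℝ≥0} (hv : v ≠ 0) :
    Tendsto (gaussianPDFReal μ v) (cocompact ℝ) (nhds 0) := by
  have hpos : 0 < (2 * (v : ℝ))⁻¹ := by positivity
  have hcentered := ((tendsto_rpow_abs_mul_exp_neg_mul_sq_cocompact hpos 0).const_mul
    (√(2 * Real.pi * v))⁻¹).comp (Homeomorph.subRight μ).isClosedEmbedding.tendsto_cocompact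
  rw [mul_zero] at hcentered
  refine hcentered.congr fun x => ?_
  simp only [gaussianPDFReal, Function.comp_apply, Real.rpow_zero, one_mul,
    Homeomorph.subRight_apply, neg_div, neg_mul, ← div_eq_inv_mul]

theorem gaussianPDFReal_zero_inv_sq_zero (r : ℝ≥0) :
    gaussianPDFReal 0 (r ^ 2)⁻¹ 0 = (√(2 * Real.pi))⁻¹ * r := by
  simp [gaussianPDFReal, mul_comm]

variable {F F' : ℝ → ℝ} {μ C : ℝ} {v : ℝ≥0}

theorem hasDerivAt_gaussianPDFReal_mul (hF : ∀ t, HasDerivAt F (F' t) t) (t : ℝ) :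
    HasDerivAt (fun t => gaussianPDFReal μ v t * F t)
      (gaussianPDFReal μ v t * (F' t - F t * ((t - μ) / v))) t := by
  refine ((hasDerivAt_gaussianPDFReal μ v t).mul (hF t)).congr_deriv ?_
  ring

theorem tendsto_gaussianPDFReal_mul_cocompact (hv : v ≠ 0) (hC : ∀ t, ‖F t‖ ≤ C) :
    Tendsto (fun t => gaussianPDFReal μ v t * F t) (cocompact ℝ) (nhds 0) :=
  (tendsto_gaussianPDFReal_cocompact μ hv).zero_mul_isBoundedUnder_le (isBoundedUnder_of ⟨C, hC⟩)

theorem integrable_gaussianPDFReal_mul_sub (hv : v ≠ 0) (hF : ∀ t, HasDerivAt F (F' t) t)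
    (hF' : Integrable F' (gaussianReal μ v)) (hC : ∀ t, ‖F t‖ ≤ C) :
    Integrable (fun t => gaussianPDFReal μ v t * (F' t - F t * ((t - μ) / v))) := by
  have hcont : Continuous F := continuous_iff_continuousAt.2 fun t => (hF t).continuousAt
  have hlin : Integrable (fun t => (t - μ) / v) (gaussianReal μ v) :=
    ((IsGaussian.integrable_id (μ := gaussianReal μ v)).sub (integrable_const μ)).div_const _
  have hintegrable := hF'.sub (hlin.bdd_mul hcont.aestronglyMeasurable (.of_forall hC))
  rw [gaussianReal_of_var_ne_zero μ hv, integrable_withDensity_iff_integrable_smul'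
    (measurable_gaussianPDF μ v) (.of_forall fun _ => gaussianPDF_lt_top)] at hintegrable
  simpa only [toReal_gaussianPDF, smul_eq_mul] using! hintegrable

theorem integral_gaussianReal_deriv_sub_mul (hv : v ≠ 0) (hF : ∀ t, HasDerivAt F (F' t) t)
    (hF' : Integrable F' (gaussianReal μ v)) (hC : ∀ t, ‖F t‖ ≤ C) :
    ∫ t, (F' t - F t * ((t - μ) / v)) ∂gaussianReal μ v = 0 := by
  rw [integral_gaussianReal_eq_integral_smul hv]
  simp only [smul_eq_mul]
  rw [integral_of_hasDerivAt_of_tendsto (hasDerivAt_gaussianPDFReal_mul hF)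
    (integrable_gaussianPDFReal_mul_sub hv hF hF' hC)
    ((tendsto_gaussianPDFReal_mul_cocompact hv hC).mono_left atBot_le_cocompact)
    ((tendsto_gaussianPDFReal_mul_cocompact hv hC).mono_left atTop_le_cocompact), sub_zero]

theorem setIntegral_Ioi_gaussianReal_deriv_sub_mul (hv : v ≠ 0) (hF : ∀ t, HasDerivAt F (F' t) t)
    (hF' : Integrable F' (gaussianReal μ v)) (hC : ∀ t, ‖F t‖ ≤ C) (a : ℝ) :
    ∫ t in Set.Ioi a, (F' t - F t * ((t - μ) / v)) ∂gaussianReal μ v =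
      -(gaussianPDFReal μ v a * F a) := by
  rw [gaussianReal_of_var_ne_zero μ hv, setIntegral_withDensity_eq_setIntegral_toReal_smul
    (measurable_gaussianPDF μ v) (.of_forall fun _ => gaussianPDF_lt_top) _ measurableSet_Ioi]
  simp only [toReal_gaussianPDF, smul_eq_mul]
  rw [integral_Ioi_of_hasDerivAt_of_tendsto' (fun t _ => hasDerivAt_gaussianPDFReal_mul hF t)
    (integrable_gaussianPDFReal_mul_sub hv hF hF' hC).integrableOn
    ((tendsto_gaussianPDFReal_mul_cocompact hv hC).mono_left atTop_le_cocompact), zero_sub]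

end Stein

section HalfSpace

open scoped InnerProductSpace

/-- The open half-space with inner normal `w`. -/
def halfSpace {E : Type*} [NormedAddCommGroup E] [InnerProductSpace ℝ E] (w : E) : Set E :=
  {x | 0 < ⟪w, x⟫_ℝ}

theorem measurableSet_halfSpace {E : Type*} [NormedAddCommGroup E] [InnerProductSpace ℝ E]
    [MeasurableSpace E] [OpensMeasurableSpace E] (w : E) : MeasurableSet (halfSpace w) :=
  (isOpen_lt continuous_const (innerSL ℝ w).continuous).measurableSet

theorem norm_indicator_one_le {X : Type*} (s : Set X) (x : X) :
    ‖s.indicator (fun _ => (1 : ℝ)) x‖ ≤ 1 :=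
  (norm_indicator_le_norm_self _ x).trans_eq norm_one

theorem integral_indicator_one_mul {X : Type*} [MeasurableSpace X] {μ : Measure X} {s : Set X}
    (hs : MeasurableSet s) (f : X → ℝ) :
    ∫ x, s.indicator (fun _ => (1 : ℝ)) x * f x ∂μ = ∫ x in s, f x ∂μ := by
  classical
  simp only [← integral_indicator hs, Set.indicator_apply, ite_mul, one_mul, zero_mul]

theorem add_smul_mem_halfSpace_iff {E : Type*} [NormedAddCommGroup E] [InnerProductSpace ℝ E]
    {w y : E} (hw : w ≠ 0) (hy : ⟪w, y⟫_ℝ = 0) (t : ℝ) : y + t • w ∈ halfSpace w ↔ 0 < t := by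
  rw [halfSpace, Set.mem_ofPred_eq, inner_add_right, hy, zero_add, real_inner_smul_right,
    mul_pos_iff_of_pos_right (real_inner_self_pos.2 hw)]

variable {n : ℕ} {u g : EuclideanSpace ℝ (Fin n) → ℝ} {h w : EuclideanSpace ℝ (Fin n)} {C : ℝ}

theorem setOf_W_pos_eq_halfSpace (n k : ℕ) : {x | 0 < W n k x} = halfSpace (walkVector n k) := by
  simp only [halfSpace, inner_walkVector]

theorem walkVector_self_ne_zero (hn : n ≠ 0) : walkVector n n ≠ 0 := fun hzero => by
  have : NeZero n := ⟨hn⟩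
  simpa [walkVector] using congrArg (fun v : EuclideanSpace ℝ (Fin n) => v 0) hzero

theorem adjDeriv_add (h h' : EuclideanSpace ℝ (Fin n)) (g : EuclideanSpace ℝ (Fin n) → ℝ)
    (x : EuclideanSpace ℝ (Fin n)) : adjDeriv (h + h') g x = adjDeriv h g x + adjDeriv h' g x := by
  simp only [adjDeriv, map_add, inner_add_left]
  ring

theorem adjDeriv_smul (c : ℝ) (h : EuclideanSpace ℝ (Fin n)) (g : EuclideanSpace ℝ (Fin n) → ℝ)
    (x : EuclideanSpace ℝ (Fin n)) : adjDeriv (c • h) g x = c * adjDeriv h g x := by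
  simp only [adjDeriv, map_smul, real_inner_smul_left, smul_eq_mul]
  ring

theorem IsTestFunction.integrable_mul_adjDeriv (hg : IsTestFunction g) (hu : Measurable u)
    (hC : ∀ x, ‖u x‖ ≤ C) (h : EuclideanSpace ℝ (Fin n)) :
    Integrable (fun x => u x * adjDeriv h g x) (γ n) := by
  obtain ⟨B, hB⟩ := hg.exists_norm_le
  obtain ⟨B', hB'⟩ := hg.exists_norm_fderiv_le
  have hderiv : Integrable (fun x => fderiv ℝ g x h) (γ n) :=
    .of_bound ((hg.contDiff.continuous_fderiv (by simp)).clm_apply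
      continuous_const).aestronglyMeasurable (B' * ‖h‖)
      (.of_forall fun x => (fderiv ℝ g x).le_of_opNorm_le (hB' x) h)
  have hinner : Integrable (fun x : EuclideanSpace ℝ (Fin n) => ⟪h, x⟫_ℝ) (γ n) :=
    (innerSL ℝ h).integrable_comp IsGaussian.integrable_id
  have hmul : Integrable (fun x => g x * ⟪h, x⟫_ℝ) (γ n) :=
    hinner.bdd_mul hg.contDiff.continuous.aestronglyMeasurable (.of_forall hB)
  exact (hderiv.sub hmul).bdd_mul hu.aestronglyMeasurable (.of_forall hC)

theorem IsTestFunction.hasDerivAt_add_smul (hg : IsTestFunction g)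
    (y h : EuclideanSpace ℝ (Fin n)) (t : ℝ) :
    HasDerivAt (fun t : ℝ => g (y + t • h)) (fderiv ℝ g (y + t • h) h) t := by
  have hline : HasDerivAt (fun t : ℝ => y + t • h) h t := by
    simpa using ((hasDerivAt_id t).smul_const h).const_add y
  exact (hg.contDiff.differentiable (by simp) _).hasFDerivAt.comp_hasDerivAt t hline

theorem IsTestFunction.integrable_fderiv_add_smul (hg : IsTestFunction g)
    (y h : EuclideanSpace ℝ (Fin n)) (μ : Measure ℝ) [IsFiniteMeasure μ] :
    Integrable (fun t : ℝ => fderiv ℝ g (y + t • h) h) μ := by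
  obtain ⟨B, hB⟩ := hg.exists_norm_fderiv_le
  have hcont : Continuous fun t : ℝ => fderiv ℝ g (y + t • h) h :=
    ((hg.contDiff.continuous_fderiv (by simp)).comp (by fun_prop)).clm_apply continuous_const
  exact .of_bound hcont.aestronglyMeasurable (B * ‖h‖)
    (.of_forall fun t => (fderiv ℝ g _).le_of_opNorm_le (hB _) h)

theorem integral_mul_adjDeriv_eq_integral_integral (hh : h ≠ 0)
    (hintegrable : Integrable (fun x => u x * adjDeriv h g x) (γ n)) :
    ∫ x, u x * adjDeriv h g x ∂γ n = ∫ y, ∫ t, u (y + t • h) * (fderiv ℝ g (y + t • h) h -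
      g (y + t • h) * ((t - 0) / ((‖h‖₊ ^ 2)⁻¹ : NNReal)))
        ∂gaussianReal 0 (‖h‖₊ ^ 2)⁻¹ ∂hyperplaneGaussian h := by
  have : IsProbabilityMeasure ((gaussianReal 0 (‖h‖₊ ^ 2)⁻¹).map (· • h)) :=
    Measure.isProbabilityMeasure_map (by fun_prop)
  have hembed : MeasurableEmbedding fun t : ℝ => t • h :=
    (isClosedEmbedding_smul_left hh).measurableEmbedding
  rw [γ, ← hyperplaneGaussian_conv_eq_stdGaussian hh] at hintegrable ⊢
  rw [integral_conv hintegrable]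
  refine integral_congr_ae ?_
  filter_upwards [ae_hyperplaneGaussian_inner_eq_zero h] with y hy
  rw [hembed.integral_map]
  simp only [adjDeriv, inner_add_right, hy, real_inner_smul_right, real_inner_self_eq_norm_sq,
    zero_add, sub_zero, NNReal.coe_inv, NNReal.coe_pow, coe_nnnorm, div_inv_eq_mul]

theorem integral_mul_adjDeriv_eq_zero_of_invariant (hg : IsTestFunction g) (hu : Measurable u)
    (hC : ∀ x, ‖u x‖ ≤ C) (hinv : ∀ x (t : ℝ), u (x + t • h) = u x) :
    ∫ x, u x * adjDeriv h g x ∂γ n = 0 := by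
  obtain rfl | hh := eq_or_ne h 0
  · simp [adjDeriv]
  obtain ⟨B, hB⟩ := hg.exists_norm_le
  rw [integral_mul_adjDeriv_eq_integral_integral hh (hg.integrable_mul_adjDeriv hu hC h)]
  refine integral_eq_zero_of_ae (.of_forall fun y => ?_)
  simp only [hinv, integral_const_mul]
  rw [integral_gaussianReal_deriv_sub_mul (by simpa using hh) (hg.hasDerivAt_add_smul y h)
    (hg.integrable_fderiv_add_smul y h _) fun t => hB _, mul_zero, Pi.zero_apply]

theorem integral_indicator_halfSpace_mul_adjDeriv_self (hg : IsTestFunction g) (hw : w ≠ 0) :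
    ∫ x, (halfSpace w).indicator (fun _ => (1 : ℝ)) x * adjDeriv w g x ∂γ n =
      -((√(2 * Real.pi))⁻¹ * ‖w‖ * ∫ x, g x ∂hyperplaneGaussian w) := by
  obtain ⟨B, hB⟩ := hg.exists_norm_le
  have hmeas : Measurable ((halfSpace w).indicator fun _ => (1 : ℝ)) :=
    measurable_const.indicator (measurableSet_halfSpace w)
  rw [integral_mul_adjDeriv_eq_integral_integral hw
    (hg.integrable_mul_adjDeriv hmeas (norm_indicator_one_le _) w), ← integral_const_mul,
    ← integral_neg]
  refine integral_congr_ae ?_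
  filter_upwards [ae_hyperplaneGaussian_inner_eq_zero w] with y hy
  have hind (t : ℝ) : (halfSpace w).indicator (fun _ => (1 : ℝ)) (y + t • w) =
      (Set.Ioi 0).indicator (fun _ => 1) t :=
    Set.indicator_const_eq_indicator_const (add_smul_mem_halfSpace_iff hw hy t)
  simp only [hind]
  rw [integral_indicator_one_mul measurableSet_Ioi, setIntegral_Ioi_gaussianReal_deriv_sub_mul
    (by simpa using hw) (hg.hasDerivAt_add_smul y w) (hg.integrable_fderiv_add_smul y w _)
    (fun t => hB _), gaussianPDFReal_zero_inv_sq_zero, zero_smul, add_zero, coe_nnnorm]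

theorem integral_indicator_halfSpace_mul_adjDeriv (hg : IsTestFunction g) (hw : w ≠ 0)
    (h : EuclideanSpace ℝ (Fin n)) :
    ∫ x, (halfSpace w).indicator (fun _ => (1 : ℝ)) x * adjDeriv h g x ∂γ n =
      -((√(2 * Real.pi) * ‖w‖)⁻¹ * ⟪w, h⟫_ℝ * ∫ x, g x ∂hyperplaneGaussian w) := by
  have hmeas : Measurable ((halfSpace w).indicator fun _ => (1 : ℝ)) :=
    measurable_const.indicator (measurableSet_halfSpace w)
  have hintegrable := hg.integrable_mul_adjDeriv hmeas (norm_indicator_one_le (halfSpace w))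
  set c := ⟪w, h⟫_ℝ / ‖w‖ ^ 2
  set h' := h - c • w
  have hw' : ‖w‖ ≠ 0 := norm_ne_zero_iff.2 hw
  have horth : ⟪w, h'⟫_ℝ = 0 := by
    rw [inner_sub_right, real_inner_smul_right, real_inner_self_eq_norm_sq,
      div_mul_cancel₀ _ (pow_ne_zero 2 hw'), sub_self]
  have hinv (x : EuclideanSpace ℝ (Fin n)) (t : ℝ) :
      (halfSpace w).indicator (fun _ => (1 : ℝ)) (x + t • h') =
        (halfSpace w).indicator (fun _ => 1) x := by
    simp only [Set.indicator_apply, halfSpace, Set.mem_ofPred_eq, inner_add_right,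
      real_inner_smul_right, horth, mul_zero, add_zero]
  have hsplit (x : EuclideanSpace ℝ (Fin n)) :
      (halfSpace w).indicator (fun _ => (1 : ℝ)) x * adjDeriv h g x =
        c * ((halfSpace w).indicator (fun _ => 1) x * adjDeriv w g x) +
          (halfSpace w).indicator (fun _ => 1) x * adjDeriv h' g x := by
    rw [← add_sub_cancel (c • w) h, adjDeriv_add, adjDeriv_smul]
    ring
  simp only [hsplit]
  rw [integral_add ((hintegrable w).const_mul c) (hintegrable h'), integral_const_mul,
    integral_indicator_halfSpace_mul_adjDeriv_self hg hw,
    integral_mul_adjDeriv_eq_zero_of_invariant hg hmeas (norm_indicator_one_le _) hinv, add_zero]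
  simp only [c]
  field_simp

/-- The measure-derivative of the indicator of `halfSpace w`, for `w ≠ 0`: the Gaussian measure of
the boundary hyperplane times `(2π)^(-1/2)` times the inner unit normal. -/
def halfSpaceDeriv (w : EuclideanSpace ℝ (Fin n)) :
    VectorMeasure (EuclideanSpace ℝ (Fin n)) (EuclideanSpace ℝ (Fin n)) :=
  (hyperplaneGaussian w).withDensityᵥ fun _ => (√(2 * Real.pi) * ‖w‖)⁻¹ • w

theorem variation_halfSpaceDeriv (hw : w ≠ 0) :
    (halfSpaceDeriv w).variation =
      ENNReal.ofReal (√(2 * Real.pi))⁻¹ • hyperplaneGaussian w := by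
  have hnorm : ‖(√(2 * Real.pi) * ‖w‖)⁻¹ • w‖ = (√(2 * Real.pi))⁻¹ := by
    rw [norm_smul, norm_inv, norm_mul, norm_norm, mul_inv, mul_assoc,
      inv_mul_cancel₀ (norm_ne_zero_iff.2 hw), mul_one, Real.norm_of_nonneg (Real.sqrt_nonneg _)]
  rw [halfSpaceDeriv, variation_withDensityᵥ_const, ← ofReal_norm, hnorm]

theorem isMeasureDeriv_halfSpaceDeriv (hw : w ≠ 0) :
    IsMeasureDeriv ((halfSpace w).indicator fun _ => (1 : ℝ)) (halfSpaceDeriv w) where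
  memLp := memLp_indicator_const 2 (measurableSet_halfSpace w) 1 (.inr (measure_ne_top _ _))
  finite_variation := by
    rw [variation_halfSpaceDeriv hw]
    exact Measure.smul_finite _ ENNReal.ofReal_ne_top
  integral_eq h g hg := by
    rw [halfSpaceDeriv, vectorIntegral_component_withDensityᵥ_const,
      integral_indicator_halfSpace_mul_adjDeriv hg hw, neg_neg, real_inner_smul_right,
      real_inner_comm]

theorem perimeterMeasure_halfSpace (hw : w ≠ 0) :
    perimeterMeasure (halfSpace w) =
      ENNReal.ofReal (√(2 * Real.pi))⁻¹ • hyperplaneGaussian w := by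
  rw [perimeterMeasure, (isMeasureDeriv_halfSpaceDeriv hw).measureDeriv_eq,
    variation_halfSpaceDeriv hw]

end HalfSpace

end GaussianWalk

end

theorem mainTheorem5 (n : ℕ) (hn : 1 ≤ n) :
    (GaussianWalk.γ n).real (GaussianWalk.A n) = (Nat.choose (2 * n) n : ℝ) / 4 ^ n ∧
    (∃! D : VectorMeasure (EuclideanSpace ℝ (Fin n)) (EuclideanSpace ℝ (Fin n)),
      GaussianWalk.IsMeasureDeriv
        ({x | 0 < GaussianWalk.W n n x}.indicator fun _ => (1 : ℝ)) D) ∧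
    0 < (GaussianWalk.perimeterMeasure {x | 0 < GaussianWalk.W n n x}).real Set.univ ∧
    GaussianWalk.condProbTerminalZero n (GaussianWalk.A n) = 1 / (n : ℝ) := by
  have hn' : n ≠ 0 := Nat.one_le_iff_ne_zero.1 hn
  have hw := GaussianWalk.walkVector_self_ne_zero hn'
  have hpos : 0 < (√(2 * Real.pi))⁻¹ := by positivity
  have hperimeter (s : Set (EuclideanSpace ℝ (Fin n))) :
      (GaussianWalk.perimeterMeasure {x | 0 < GaussianWalk.W n n x}).real s =
        (√(2 * Real.pi))⁻¹ *
          (GaussianWalk.hyperplaneGaussian (GaussianWalk.walkVector n n)).real s := by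
    rw [GaussianWalk.setOf_W_pos_eq_halfSpace, GaussianWalk.perimeterMeasure_halfSpace hw,
      measureReal_ennreal_smul_apply, ENNReal.toReal_ofReal hpos.le]
  refine ⟨?_, ?_, ?_, ?_⟩
  · rw [GaussianWalk.stdGaussian_real_A, Nat.centralBinom_eq_two_mul_choose]
  · rw [GaussianWalk.setOf_W_pos_eq_halfSpace]
    have hD := GaussianWalk.isMeasureDeriv_halfSpaceDeriv hw
    exact ⟨_, hD, fun D' hD' => hD'.unique hD⟩
  · rwa [hperimeter, probReal_univ, mul_one]
  · rw [GaussianWalk.condProbTerminalZero, hperimeter, hperimeter, probReal_univ,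
      mul_div_mul_left _ _ hpos.ne', div_one, GaussianWalk.hyperplaneGaussian_real_A hn']
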